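/- For $x\in(0,1)$ irrational, let $G(t)=\{1/t\}$ be the Gauss map, and let $\eta_0(x)=1$ and $\eta_j(x)=G^{j-1}(x)$ for $j\ge 1$. Yoccoz's Brjuno function is $$\mathcal B(x)=\sum_{i=1}^{\infty}\eta_0(x)\,\eta_1(x)\cdots\eta_{i-1}(x)\cdot\bigl(-\log \eta_i(x)\bigr)\in[0,+\infty],$$ and $\mathcal B(x)=+\infty$ for rational $x$. A real number $x$ is computable if there is an algorithm which on input $n\in\mathbb N$ outputs a dyadic rational $d_n$ with $|x-d_n|<2^{-n}$; a real number $y$ is left-computable if there is an algorithm which on input $n\in\mathbb N$ outputs a dyadic rational $a_n$ such that the sequence $(a_n)$ is nondecreasing and converges to $y$. Let $w_*=\frac{\sqrt5-1}{2}$. If $y\in[\mathcal B(w_*),+\infty)$ is left-computable, then there exists a computable $x\in(0,1)$ with $\mathcal B(x)=y$. -/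

import Mathlib

namespace BrjunoComputability

/-- The dyadic rational `(a - b) / 2 ^ k` named by the code `(a, b, k)`. Every dyadic rational
`p * 2 ^ q` with `p q : ℤ` has such a name, and names can be converted algorithmically. -/
noncomputable def dyadic (c : ℕ × ℕ × ℕ) : ℝ :=
  ((c.1 : ℝ) - (c.2.1 : ℝ)) / 2 ^ c.2.2

/-- A real number is computable if some algorithm, on input `n`, outputs a dyadic rational `d n`
with `|x - d n| < 2 ^ (-n)`. -/
def IsComputableReal (x : ℝ) : Prop :=
  ∃ d : ℕ → ℕ × ℕ × ℕ, Computable d ∧ ∀ n : ℕ, |x - dyadic (d n)| < 1 / 2 ^ n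

/-- A real number is left-computable if some algorithm outputs a nondecreasing sequence of dyadic
rationals converging to it. -/
def IsLeftComputable (y : ℝ) : Prop :=
  ∃ a : ℕ → ℕ × ℕ × ℕ, Computable a ∧ Monotone (fun n => dyadic (a n)) ∧
    Filter.Tendsto (fun n => dyadic (a n)) Filter.atTop (nhds y)

/-- The Gauss map `x ↦ {1 / x}`. -/
noncomputable def gaussMap (x : ℝ) : ℝ := Int.fract (1 / x)

/-- `η₀ = 1`, and `η_{j + 1} (x) = G^j (x)` with `G` the Gauss map. -/
noncomputable def eta : ℕ → ℝ → ℝ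
  | 0, _ => 1
  | j + 1, x => gaussMap^[j] x

open Classical in
/-- Yoccoz's Brjuno function
`𝓑 (x) = ∑_{i ≥ 1} η₀ (x) η₁ (x) ⋯ η_{i - 1} (x) * (- log (η_i (x)))` of an irrational
`x ∈ (0, 1)`, with values in `[0, ∞]` (all terms are nonnegative); it is `∞` at rational numbers.
It is only meant to be used on `(0, 1)`. The sum below is shifted to start at `i = 0`. -/
noncomputable def brjuno (x : ℝ) : ENNReal :=
  if Irrational x then
    ∑' i : ℕ, ENNReal.ofReal
      ((∏ j ∈ Finset.range (i + 1), eta j x) * (- Real.log (eta (i + 1) x)))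
  else ⊤

end BrjunoComputability

/-!
The number `x` is built as a continued fraction `[a 0, a 1, …]`, digit by digit, by a greedy
algorithm. Let `c n` be dyadic numbers increasing to `y`. Once `a 0, …, a (n - 1)` are known, take
for `a n` the least digit `d ≥ 1` for which a rational upper bound of the Brjuno function at
`[a 0, …, a (n - 1), d + 1, 1, 1, 1, …]`, computed with precision `2 ^ (-n)`, exceeds `c n`.

The values of the Brjuno function at `[a 0, …, a (n - 1), 1, 1, 1, …]` never exceed `y`
(`brjuno_greedyList_le`). For `n = 0` this is the assumption on `y`; a digit `1` does not change the
number; and a digit `d > 1` was chosen because the upper bound for the digit `d` is at most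
`c n ≤ y`. By lower semicontinuity (`brjuno_cf_le_of_forall_le`) the value at `x` is at most `y`.

Conversely, since the value at `x` is finite, dominated convergence (`tendsto_brjuno_cf`) shows that
the values at `[a 0, …, a (n - 1), a n + 1, 1, 1, 1, …]` converge to the value at `x`. The upper
bounds for these numbers exceed `c n` and have errors tending to zero (`bounds_listState`,
`tendsto_value_bound`), so the value at `x` is at least `y`.

The upper bounds are obtained from the recursion `𝓑 (x) = log (a + t) + 𝓑 (t) / (a + t)` for
`x = 1 / (a + t)`, starting from `𝓑 (w) = log (1 + w) / w ^ 2` at `w = [1, 1, 1, …]`. The logarithm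
of a fraction is bounded above by a harmonic sum, and the continued fractions are enclosed between
two fractions. Everything is arithmetic of natural numbers, hence primitive recursive
(`primrec₂_listState`); the search for the digit is unbounded but always succeeds, because a large
digit makes the Brjuno function large (`exists_exceeds`). So the digits, and with them `x`, are
computable (`isComputableReal_cf_greedySeq`).
-/

namespace BrjunoComputability

open Filter Topology

/-! ### Rational bounds by a primitive recursive algorithm -/

/-- `harmonicCode m k` is a fraction (numerator, denominator) equal to `∑ j < k, 1 / (m + j)`. -/
def harmonicCode (m k : ℕ) : ℕ × ℕ :=
  Nat.rec (0, 1) (fun j r => (r.1 * (m + j) + r.2, r.2 * (m + j))) k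

/-- A fraction exceeding `log (p / q)` by at most `1 / M`, for `0 < q ≤ p` and `0 < M`: the
harmonic sum `∑ 1 / j` over `q * M ≤ j < p * M`. -/
def logCode (M p q : ℕ) : ℕ × ℕ := harmonicCode (q * M) ((p - q) * M)

/-- The state `(l₁, l₂, h₁, h₂, u₁, u₂)` of the algorithm stands for the rational numbers
`l₁ / l₂`, `h₁ / h₂` and `u₁ / u₂`: a lower and an upper bound of a number with a given continued
fraction, and an upper bound of the Brjuno function at that number. -/
abbrev BoundState : Type := ℕ × ℕ × ℕ × ℕ × ℕ × ℕ

/-- Bounds for `w = [1, 1, 1, …]`, of precision `1 / M`. The bounds of `w = (√5 - 1) / 2` come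
from the integer square root of `5 * M ^ 2`, and the upper bound of the Brjuno function from its
value `log (1 + w) / w ^ 2` at `w`. -/
def baseState (M : ℕ) : BoundState :=
  (Nat.sqrt (5 * (M * M)) - M, 2 * M, Nat.sqrt (5 * (M * M)) + 1 - M, 2 * M,
    (logCode M (2 * M + (Nat.sqrt (5 * (M * M)) + 1 - M)) (2 * M)).1 * ((2 * M) * (2 * M)),
    (logCode M (2 * M + (Nat.sqrt (5 * (M * M)) + 1 - M)) (2 * M)).2 *
      ((Nat.sqrt (5 * (M * M)) - M) * (Nat.sqrt (5 * (M * M)) - M)))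

/-- The bounds for `[a, t]` obtained from bounds for `t`: if `x = 1 / (a + t)`, then the Brjuno
function at `x` is `log (a + t)` plus its value at `t` divided by `a + t`. -/
def stepState (M a : ℕ) (s : BoundState) : BoundState :=
  (s.2.2.2.1, a * s.2.2.2.1 + s.2.2.1, s.2.1, a * s.2.1 + s.1,
    (logCode M (a * s.2.2.2.1 + s.2.2.1) s.2.2.2.1).1 *
        (s.2.2.2.2.2 * (a * s.2.1 + s.1)) +
      s.2.2.2.2.1 * s.2.1 * (logCode M (a * s.2.2.2.1 + s.2.2.1) s.2.2.2.1).2,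
    (logCode M (a * s.2.2.2.1 + s.2.2.1) s.2.2.2.1).2 * (s.2.2.2.2.2 * (a * s.2.1 + s.1)))

/-- The bounds for `[I, 1, 1, 1, …]` computed with precision `1 / M`. -/
def listState (M : ℕ) (I : List ℕ) : BoundState :=
  I.foldr (stepState M) (baseState M)

theorem primrec_two_pow : Primrec fun n : ℕ => 2 ^ n := by
  refine (Primrec.nat_rec₁ (f := fun _ r => 2 * r) 1
    (Primrec.nat_mul.comp (Primrec.const 2) Primrec.snd).to₂).of_eq fun n => ?_
  induction n with
  | zero => rfl
  | succ n ih => rw [pow_succ, mul_comm, ← ih]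

theorem primrec₂_harmonicCode : Primrec₂ harmonicCode := by
  refine Primrec.nat_rec' (f := fun x : ℕ × ℕ => x.2) (g := fun _ => ((0, 1) : ℕ × ℕ))
    (h := fun x r => (r.2.1 * (x.1 + r.1) + r.2.2, r.2.2 * (x.1 + r.1)))
    Primrec.snd (Primrec.const _) ?_
  have hx : Primrec fun z : (ℕ × ℕ) × ℕ × ℕ × ℕ => z.1.1 + z.2.1 :=
    Primrec.nat_add.comp (Primrec.fst.comp Primrec.fst) (Primrec.fst.comp Primrec.snd)
  have h1 : Primrec fun z : (ℕ × ℕ) × ℕ × ℕ × ℕ => z.2.2.1 :=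
    Primrec.fst.comp (Primrec.snd.comp Primrec.snd)
  have h2 : Primrec fun z : (ℕ × ℕ) × ℕ × ℕ × ℕ => z.2.2.2 :=
    Primrec.snd.comp (Primrec.snd.comp Primrec.snd)
  exact ((Primrec.nat_add.comp (Primrec.nat_mul.comp h1 hx) h2).pair
    (Primrec.nat_mul.comp h2 hx)).to₂

theorem Primrec.logCode {α : Type*} [Primcodable α] {M p q : α → ℕ} (hM : Primrec M)
    (hp : Primrec p) (hq : Primrec q) : Primrec fun x => logCode (M x) (p x) (q x) :=
  primrec₂_harmonicCode.comp (Primrec.nat_mul.comp hq hM)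
    (Primrec.nat_mul.comp (Primrec.nat_sub.comp hp hq) hM)

theorem primrec_baseState : Primrec baseState := by
  have hs : Primrec fun M : ℕ => Nat.sqrt (5 * (M * M)) := Primrec.nat_sqrt.comp
    (Primrec.nat_mul.comp (Primrec.const 5) (Primrec.nat_mul.comp .id .id))
  have hl : Primrec fun M : ℕ => Nat.sqrt (5 * (M * M)) - M := Primrec.nat_sub.comp hs .id
  have hh : Primrec fun M : ℕ => Nat.sqrt (5 * (M * M)) + 1 - M :=
    Primrec.nat_sub.comp (Primrec.succ.comp hs) .id
  have hd : Primrec fun M : ℕ => 2 * M := Primrec.nat_double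
  have hL := Primrec.logCode .id (Primrec.nat_add.comp hd hh) hd
  exact hl.pair <| hd.pair <| hh.pair <| hd.pair <|
    (Primrec.nat_mul.comp (Primrec.fst.comp hL) (Primrec.nat_mul.comp hd hd)).pair
      (Primrec.nat_mul.comp (Primrec.snd.comp hL) (Primrec.nat_mul.comp hl hl))

theorem Primrec.stepState {α : Type*} [Primcodable α] {M a : α → ℕ} {s : α → BoundState}
    (hM : Primrec M) (ha : Primrec a) (hs : Primrec s) :
    Primrec fun x => stepState (M x) (a x) (s x) := by
  have h1 : Primrec fun x => (s x).1 := Primrec.fst.comp hs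
  have t1 : Primrec fun x => (s x).2 := Primrec.snd.comp hs
  have h2 : Primrec fun x => (s x).2.1 := Primrec.fst.comp t1
  have t2 : Primrec fun x => (s x).2.2 := Primrec.snd.comp t1
  have h3 : Primrec fun x => (s x).2.2.1 := Primrec.fst.comp t2
  have t3 : Primrec fun x => (s x).2.2.2 := Primrec.snd.comp t2
  have h4 : Primrec fun x => (s x).2.2.2.1 := Primrec.fst.comp t3
  have t4 : Primrec fun x => (s x).2.2.2.2 := Primrec.snd.comp t3
  have h5 : Primrec fun x => (s x).2.2.2.2.1 := Primrec.fst.comp t4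
  have h6 : Primrec fun x => (s x).2.2.2.2.2 := Primrec.snd.comp t4
  have hh : Primrec fun x => a x * (s x).2.2.2.1 + (s x).2.2.1 :=
    Primrec.nat_add.comp (Primrec.nat_mul.comp ha h4) h3
  have hl : Primrec fun x => a x * (s x).2.1 + (s x).1 :=
    Primrec.nat_add.comp (Primrec.nat_mul.comp ha h2) h1
  have hL := Primrec.logCode hM hh h4
  have hd := Primrec.nat_mul.comp h6 hl
  exact h4.pair <| hh.pair <| h2.pair <| hl.pair <|
    (Primrec.nat_add.comp (Primrec.nat_mul.comp (Primrec.fst.comp hL) hd)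
      (Primrec.nat_mul.comp (Primrec.nat_mul.comp h5 h2) (Primrec.snd.comp hL))).pair
      (Primrec.nat_mul.comp (Primrec.snd.comp hL) hd)

theorem primrec₂_listState : Primrec₂ listState := by
  refine Primrec.list_foldr (f := fun x : ℕ × List ℕ => x.2) (g := fun x => baseState x.1)
    (h := fun x r => stepState x.1 r.1 r.2) Primrec.snd
    (primrec_baseState.comp Primrec.fst) ?_
  exact (Primrec.stepState (Primrec.fst.comp Primrec.fst) (Primrec.fst.comp Primrec.snd)
    (Primrec.snd.comp Primrec.snd)).to₂

/-- The test `u₁ / u₂ > (c₁ - c₂) / 2 ^ c₃`, for the upper bound `u₁ / u₂` of the Brjuno function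
held by a state and the dyadic number with code `c`, with the denominators cleared. -/
def exceeds (s : BoundState) (c : ℕ × ℕ × ℕ) : Bool :=
  decide (c.1 * s.2.2.2.2.2 < s.2.2.2.2.1 * 2 ^ c.2.2 + c.2.1 * s.2.2.2.2.2)

theorem primrec₂_exceeds : Primrec₂ exceeds := by
  have hu : Primrec fun x : BoundState × ℕ × ℕ × ℕ => x.1.2.2.2.2 :=
    Primrec.snd.comp <| Primrec.snd.comp <| Primrec.snd.comp <| Primrec.snd.comp Primrec.fst
  have h5 := Primrec.fst.comp hu
  have h6 := Primrec.snd.comp hu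
  have hc : Primrec fun x : BoundState × ℕ × ℕ × ℕ => x.2 := Primrec.snd
  have h1 := Primrec.fst.comp hc
  have h2 := Primrec.fst.comp (Primrec.snd.comp hc)
  have h3 := Primrec.snd.comp (Primrec.snd.comp hc)
  exact (Primrec.nat_lt.comp (Primrec.nat_mul.comp h1 h6)
    (Primrec.nat_add.comp (Primrec.nat_mul.comp h5 (primrec_two_pow.comp h3))
      (Primrec.nat_mul.comp h2 h6))).decide

/-- Unbounded search for a natural number that exists is an algorithm. -/
theorem exists_computable_least {α : Type*} [Primcodable α] {p : α → ℕ → Bool}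
    (hp : Computable₂ p) (hex : ∀ x, ∃ m, p x m = true) :
    ∃ f : α → ℕ, Computable f ∧ ∀ x, p x (f x) = true ∧ ∀ m < f x, p x m = false := by
  refine ⟨fun x => Nat.find (hex x), ?_, fun x => ⟨Nat.find_spec (hex x), fun m hm => ?_⟩⟩
  · refine (Partrec.rfind (p := fun x => (p x : ℕ →. Bool)) hp.partrec₂).of_eq_tot fun x => ?_
    refine Nat.mem_rfind.2 ⟨?_, fun {m} hm => ?_⟩
    · exact Part.mem_some_iff.2 (Nat.find_spec (hex x)).symm
    · exact Part.mem_some_iff.2 (by simpa using (Nat.find_min (hex x) hm))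
  · simpa using Nat.find_min (hex x) hm

/-! ### Infinite continued fractions -/

/-- The sequence `a` without its first `j` entries. -/
def drop (j : ℕ) (a : ℕ → ℕ) : ℕ → ℕ := fun i => a (i + j)

@[simp] theorem drop_apply (j : ℕ) (a : ℕ → ℕ) (i : ℕ) : drop j a i = a (i + j) := rfl

@[simp] theorem drop_zero (a : ℕ → ℕ) : drop 0 a = a := rfl

theorem drop_drop (i j : ℕ) (a : ℕ → ℕ) : drop i (drop j a) = drop (i + j) a :=
  funext fun k => by simp [add_assoc]

/-- The finite continued fraction `[a 0, …, a (n - 1), t]` with `t = 1`. -/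
noncomputable def cfApprox : ℕ → (ℕ → ℕ) → ℝ
  | 0, _ => 1
  | n + 1, a => 1 / (a 0 + cfApprox n (drop 1 a))

/-- The value `1 / (a 0 + 1 / (a 1 + ⋯))` of the infinite continued fraction with partial
quotients `a`, which are meant to be positive. -/
noncomputable def cf (a : ℕ → ℕ) : ℝ := limUnder atTop fun n => cfApprox n a

theorem cfApprox_mem {a : ℕ → ℕ} (ha : ∀ i, 1 ≤ a i) (n : ℕ) :
    0 < cfApprox n a ∧ cfApprox n a ≤ 1 := by
  induction n generalizing a with
  | zero => simp [cfApprox]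
  | succ n ih =>
    have h := ih (a := drop 1 a) fun i => ha _
    have h0 : (1 : ℝ) ≤ a 0 := by exact_mod_cast ha 0
    rw [cfApprox]
    exact ⟨by have := h.1; positivity, by rw [div_le_one (by linarith)]; linarith⟩

/-- Two numbers are `ε`-close if each is at most `1 + ε` times the other. -/
def Close (ε s t : ℝ) : Prop := s ≤ (1 + ε) * t ∧ t ≤ (1 + ε) * s

theorem inv_add_le_of_le {a s t ε : ℝ} (hsa : s ≤ a) (hs : 0 ≤ s) (ht : 0 ≤ t) (ha : 1 ≤ a)
    (hε : 0 ≤ ε) (h : t ≤ (1 + ε) * s) : 1 / (a + s) ≤ (1 + ε / 2) * (1 / (a + t)) := by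
  rw [mul_one_div, div_le_div_iff₀ (by linarith) (by linarith)]
  nlinarith [mul_nonneg hε (sub_nonneg.2 hsa)]

/-- A step of a continued fraction halves the relative error. -/
theorem Close.inv_add {a s t ε : ℝ} (hs : 0 ≤ s ∧ s ≤ 1) (ht : 0 ≤ t ∧ t ≤ 1) (ha : 1 ≤ a)
    (hε : 0 ≤ ε) (h : Close ε s t) : Close (ε / 2) (1 / (a + s)) (1 / (a + t)) :=
  ⟨inv_add_le_of_le (by linarith [hs.2]) hs.1 ht.1 ha hε h.2,
    inv_add_le_of_le (by linarith [ht.2]) ht.1 hs.1 ha hε h.1⟩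

theorem close_inv_add {a s t : ℝ} (hs : 0 ≤ s ∧ s ≤ 1) (ht : 0 ≤ t ∧ t ≤ 1) (ha : 1 ≤ a) :
    Close 1 (1 / (a + s)) (1 / (a + t)) := by
  constructor <;>
  · rw [mul_one_div, div_le_div_iff₀ (by linarith) (by linarith)]
    linarith

theorem Close.abs_sub_le {ε s t : ℝ} (hε : 0 ≤ ε) (hs : s ≤ 1) (ht : t ≤ 1) (h : Close ε s t) :
    |s - t| ≤ ε := by
  have h1 := h.1
  have h2 := h.2
  rw [abs_le]
  constructor <;> nlinarith

theorem close_cfApprox {a : ℕ → ℕ} (ha : ∀ i, 1 ≤ a i) (k n m : ℕ) (hn : k + 1 ≤ n)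
    (hm : k + 1 ≤ m) : Close ((1 / 2) ^ k) (cfApprox n a) (cfApprox m a) := by
  induction k generalizing a n m with
  | zero =>
    obtain ⟨n, rfl⟩ := Nat.exists_eq_add_of_le' hn
    obtain ⟨m, rfl⟩ := Nat.exists_eq_add_of_le' hm
    have hd : ∀ i, 1 ≤ drop 1 a i := fun i => ha _
    have h1 := cfApprox_mem hd n
    have h2 := cfApprox_mem hd m
    simpa [cfApprox] using close_inv_add ⟨h1.1.le, h1.2⟩ ⟨h2.1.le, h2.2⟩
      (by exact_mod_cast ha 0 : (1 : ℝ) ≤ a 0)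
  | succ k ih =>
    obtain ⟨n, rfl⟩ := Nat.exists_eq_add_of_le' (by omega : 1 ≤ n)
    obtain ⟨m, rfl⟩ := Nat.exists_eq_add_of_le' (by omega : 1 ≤ m)
    have hd : ∀ i, 1 ≤ drop 1 a i := fun i => ha _
    have h1 := cfApprox_mem hd n
    have h2 := cfApprox_mem hd m
    have := (ih hd n m (by omega) (by omega)).inv_add ⟨h1.1.le, h1.2⟩ ⟨h2.1.le, h2.2⟩
      (by exact_mod_cast ha 0 : (1 : ℝ) ≤ a 0) (by positivity)
    simpa [cfApprox, pow_succ, div_eq_mul_inv] using this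

theorem tendsto_cfApprox {a : ℕ → ℕ} (ha : ∀ i, 1 ≤ a i) :
    Tendsto (fun n => cfApprox n a) atTop (𝓝 (cf a)) := by
  have hc : CauchySeq fun n => cfApprox (n + 1) a := by
    refine cauchySeq_of_le_tendsto_0 (fun k => (1 / 2 : ℝ) ^ k) (fun n m k hn hm => ?_)
      (tendsto_pow_atTop_nhds_zero_of_lt_one (by norm_num) (by norm_num))
    exact (close_cfApprox ha k _ _ (by omega) (by omega)).abs_sub_le (by positivity)
      (cfApprox_mem ha _).2 (cfApprox_mem ha _).2
  obtain ⟨x, hx⟩ := cauchySeq_tendsto_of_complete hc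
  exact tendsto_nhds_limUnder
    ⟨x, (tendsto_add_atTop_iff_nat (f := fun n => cfApprox n a) 1).1 hx⟩

theorem cf_eq {a : ℕ → ℕ} (ha : ∀ i, 1 ≤ a i) : cf a = 1 / (a 0 + cf (drop 1 a)) := by
  have h1 := tendsto_cfApprox ha
  have h2 := tendsto_cfApprox (a := drop 1 a) fun i => ha _
  have h0 : (1 : ℝ) ≤ a 0 := by exact_mod_cast ha 0
  have hn : 0 ≤ cf (drop 1 a) :=
    ge_of_tendsto' h2 fun n => (cfApprox_mem (a := drop 1 a) (fun i => ha _) n).1.le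
  refine tendsto_nhds_unique ((tendsto_add_atTop_iff_nat 1).2 h1) ?_
  simp only [cfApprox]
  exact tendsto_const_nhds.div (tendsto_const_nhds.add h2) (by positivity)

theorem cf_nonneg {a : ℕ → ℕ} (ha : ∀ i, 1 ≤ a i) : 0 ≤ cf a :=
  ge_of_tendsto' (tendsto_cfApprox ha) fun n => (cfApprox_mem ha n).1.le

theorem cf_pos {a : ℕ → ℕ} (ha : ∀ i, 1 ≤ a i) : 0 < cf a := by
  have h0 : (1 : ℝ) ≤ a 0 := by exact_mod_cast ha 0
  have := cf_nonneg (a := drop 1 a) fun i => ha _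
  rw [cf_eq ha]
  positivity

theorem cf_lt_one {a : ℕ → ℕ} (ha : ∀ i, 1 ≤ a i) : cf a < 1 := by
  have h0 : (1 : ℝ) ≤ a 0 := by exact_mod_cast ha 0
  have := cf_pos (a := drop 1 a) fun i => ha _
  rw [cf_eq ha, div_lt_one (by linarith)]
  linarith

theorem cf_mem {a : ℕ → ℕ} (ha : ∀ i, 1 ≤ a i) : 0 ≤ cf a ∧ cf a ≤ 1 :=
  ⟨cf_nonneg ha, (cf_lt_one ha).le⟩

theorem one_div_cf {a : ℕ → ℕ} (ha : ∀ i, 1 ≤ a i) : 1 / cf a = a 0 + cf (drop 1 a) := by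
  rw [cf_eq ha, one_div_one_div]

theorem gaussMap_cf {a : ℕ → ℕ} (ha : ∀ i, 1 ≤ a i) : gaussMap (cf a) = cf (drop 1 a) := by
  have hd : ∀ i, 1 ≤ drop 1 a i := fun i => ha _
  rw [gaussMap, one_div_cf ha, Int.fract_natCast_add]
  exact Int.fract_eq_self.2 ⟨cf_nonneg hd, cf_lt_one hd⟩

theorem eta_succ_cf {a : ℕ → ℕ} (ha : ∀ i, 1 ≤ a i) (j : ℕ) :
    eta (j + 1) (cf a) = cf (drop j a) := by
  have h : gaussMap^[j] (cf a) = cf (drop j a) := by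
    induction j with
    | zero => rfl
    | succ j ih =>
      rw [Function.iterate_succ_apply', ih, gaussMap_cf (a := drop j a) fun i => ha _, drop_drop, add_comm]
  exact h

/-- An infinite continued fraction is irrational: if `[a 0, a 1, …] = p / q`, then
`[a 1, a 2, …]` is a fraction with the smaller denominator `p`. -/
theorem cf_ne_div (q : ℕ) : ∀ {a : ℕ → ℕ}, (∀ i, 1 ≤ a i) → ∀ p : ℕ, cf a ≠ p / q := by
  induction q using Nat.strong_induction_on with
  | _ q ih =>
    intro a ha p h
    have hd : ∀ i, 1 ≤ drop 1 a i := fun i => ha _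
    have h0 := cf_pos ha
    have h1 := cf_lt_one ha
    rw [h] at h0 h1
    have hq : 0 < q := Nat.pos_of_ne_zero fun hq => by simp [hq] at h0
    have hq' : (0 : ℝ) < q := by exact_mod_cast hq
    have hp' : (0 : ℝ) < p := by rwa [div_pos_iff_of_pos_right hq'] at h0
    rw [div_lt_one hq'] at h1
    have hs := one_div_cf ha
    rw [h, one_div_div] at hs
    have hle : a 0 * p ≤ q := by
      have : (a 0 : ℝ) ≤ q / p := by linarith [cf_nonneg hd]
      rw [le_div_iff₀ hp'] at this
      exact_mod_cast this
    refine ih p (by exact_mod_cast h1) hd (q - a 0 * p) ?_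
    rw [Nat.cast_sub hle, sub_div, hs]
    push_cast
    field_simp
    ring

theorem irrational_cf {a : ℕ → ℕ} (ha : ∀ i, 1 ≤ a i) : Irrational (cf a) := by
  rintro ⟨r, hr⟩
  have h0 : 0 ≤ r := by
    have := cf_nonneg ha
    rw [← hr] at this
    exact_mod_cast this
  refine cf_ne_div r.den ha r.num.toNat ?_
  have hn : ((r.num.toNat : ℕ) : ℝ) = (r.num : ℝ) := by
    exact_mod_cast Int.toNat_of_nonneg (Rat.num_nonneg.2 h0)
  rw [hn, ← hr, Rat.cast_def]

theorem close_cf {a b : ℕ → ℕ} (ha : ∀ i, 1 ≤ a i) (hb : ∀ i, 1 ≤ b i) (k : ℕ)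
    (h : ∀ i ≤ k, a i = b i) : Close ((1 / 2) ^ k) (cf a) (cf b) := by
  induction k generalizing a b with
  | zero =>
    rw [cf_eq ha, cf_eq hb, ← h 0 le_rfl, pow_zero]
    exact close_inv_add (cf_mem fun i => ha _) (cf_mem fun i => hb _)
      (by exact_mod_cast ha 0 : (1 : ℝ) ≤ a 0)
  | succ k ih =>
    have := (ih (a := drop 1 a) (b := drop 1 b) (fun i => ha _) (fun i => hb _)
      fun i hi => h _ (by omega)).inv_add (cf_mem fun i => ha _) (cf_mem fun i => hb _)
      (by exact_mod_cast ha 0 : (1 : ℝ) ≤ a 0) (by positivity)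
    rw [cf_eq ha, cf_eq hb, ← h 0 (by omega), pow_succ, mul_one_div]
    exact this

theorem cf_one : cf (fun _ => 1) = (Real.sqrt 5 - 1) / 2 := by
  have h := cf_eq (a := fun _ => 1) fun _ => le_rfl
  have h0 := cf_pos (a := fun _ => 1) fun _ => le_rfl
  have hd : drop 1 (fun _ => 1) = fun _ => 1 := rfl
  rw [hd, eq_div_iff (by positivity)] at h
  set w := cf fun _ => 1
  have hs : Real.sqrt 5 = 2 * w + 1 := by
    rw [Real.sqrt_eq_iff_mul_self_eq_of_pos (by positivity)]
    push_cast at h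
    nlinarith
  rw [hs]
  ring

/-! ### The Brjuno function of a continued fraction -/

/-- The product `η₀ η₁ ⋯ η_i` at the continued fraction with partial quotients `a`. -/
noncomputable def etaProd (i : ℕ) (a : ℕ → ℕ) : ℝ := ∏ j ∈ Finset.range i, cf (drop j a)

/-- The `i`-th term of the series for the Brjuno function at the continued fraction with partial
quotients `a`. -/
noncomputable def brjunoTerm (i : ℕ) (a : ℕ → ℕ) : ℝ := etaProd i a * (-Real.log (cf (drop i a)))

theorem etaProd_succ (i : ℕ) (a : ℕ → ℕ) : etaProd (i + 1) a = etaProd i a * cf (drop i a) :=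
  Finset.prod_range_succ _ _

theorem etaProd_succ' (i : ℕ) (a : ℕ → ℕ) : etaProd (i + 1) a = cf a * etaProd i (drop 1 a) := by
  rw [etaProd, Finset.prod_range_succ', mul_comm]
  simp [etaProd, drop_drop]

theorem etaProd_pos {a : ℕ → ℕ} (ha : ∀ i, 1 ≤ a i) (i : ℕ) : 0 < etaProd i a :=
  Finset.prod_pos fun _ _ => cf_pos fun _ => ha _

theorem neg_log_cf_nonneg {a : ℕ → ℕ} (ha : ∀ i, 1 ≤ a i) : 0 ≤ -Real.log (cf a) :=
  neg_nonneg.2 (Real.log_nonpos (cf_nonneg ha) (cf_lt_one ha).le)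

theorem brjunoTerm_nonneg {a : ℕ → ℕ} (ha : ∀ i, 1 ≤ a i) (i : ℕ) : 0 ≤ brjunoTerm i a :=
  mul_nonneg (etaProd_pos ha i).le (neg_log_cf_nonneg fun _ => ha _)

theorem brjuno_cf {a : ℕ → ℕ} (ha : ∀ i, 1 ≤ a i) :
    brjuno (cf a) = ∑' i, ENNReal.ofReal (brjunoTerm i a) := by
  rw [brjuno, if_pos (irrational_cf ha)]
  congr 1
  ext i
  have hp : ∏ j ∈ Finset.range i, eta (j + 1) (cf a) = etaProd i a :=
    Finset.prod_congr rfl fun j _ => eta_succ_cf ha j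
  rw [Finset.prod_range_succ', eta_succ_cf ha, hp, eta, mul_one, brjunoTerm]

theorem brjuno_cf_ne_top_iff {a : ℕ → ℕ} (ha : ∀ i, 1 ≤ a i) :
    brjuno (cf a) ≠ ⊤ ↔ Summable fun i => brjunoTerm i a := by
  rw [brjuno_cf ha]
  refine ⟨fun h => ?_, fun h => h.tsum_ofReal_ne_top⟩
  simpa [ENNReal.toReal_ofReal (brjunoTerm_nonneg ha _)] using ENNReal.summable_toReal h

theorem brjuno_cf_eq_ofReal {a : ℕ → ℕ} (ha : ∀ i, 1 ≤ a i)
    (hs : Summable fun i => brjunoTerm i a) :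
    brjuno (cf a) = ENNReal.ofReal (∑' i, brjunoTerm i a) := by
  rw [brjuno_cf ha, ENNReal.ofReal_tsum_of_nonneg (brjunoTerm_nonneg ha) hs]

theorem brjuno_cf_eq_add {a : ℕ → ℕ} (ha : ∀ i, 1 ≤ a i) :
    brjuno (cf a) =
      ENNReal.ofReal (-Real.log (cf a)) + ENNReal.ofReal (cf a) * brjuno (cf (drop 1 a)) := by
  rw [brjuno_cf ha, brjuno_cf (a := drop 1 a) fun i => ha _, tsum_eq_zero_add' ENNReal.summable,
    ← ENNReal.tsum_mul_left]
  congr 1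
  · simp [brjunoTerm, etaProd]
  · congr 1
    ext i
    rw [← ENNReal.ofReal_mul (cf_nonneg ha), brjunoTerm, etaProd_succ', brjunoTerm, drop_drop,
      mul_assoc]

theorem brjuno_cf_ne_top_of_drop {a : ℕ → ℕ} (ha : ∀ i, 1 ≤ a i)
    (h : brjuno (cf (drop 1 a)) ≠ ⊤) : brjuno (cf a) ≠ ⊤ := by
  rw [brjuno_cf_eq_add ha]
  exact ENNReal.add_ne_top.2 ⟨ENNReal.ofReal_ne_top, ENNReal.mul_ne_top ENNReal.ofReal_ne_top h⟩

theorem toReal_brjuno_cf {a : ℕ → ℕ} (ha : ∀ i, 1 ≤ a i) (h : brjuno (cf (drop 1 a)) ≠ ⊤) :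
    (brjuno (cf a)).toReal = Real.log (a 0 + cf (drop 1 a)) +
      (brjuno (cf (drop 1 a))).toReal / (a 0 + cf (drop 1 a)) := by
  rw [brjuno_cf_eq_add ha, ENNReal.toReal_add ENNReal.ofReal_ne_top
    (ENNReal.mul_ne_top ENNReal.ofReal_ne_top h), ENNReal.toReal_mul,
    ENNReal.toReal_ofReal (neg_log_cf_nonneg ha), ENNReal.toReal_ofReal (cf_nonneg ha),
    ← Real.log_inv, ← one_div, one_div_cf ha, ← one_div_cf ha]
  field_simp

/-- Two consecutive factors have product `η / (a + η) ≤ 1 / 2`. -/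
theorem etaProd_le {a : ℕ → ℕ} (ha : ∀ i, 1 ≤ a i) (i : ℕ) : etaProd i a ≤ 2 * (3 / 4) ^ i := by
  induction i using Nat.twoStepInduction with
  | zero => simp [etaProd]
  | one => simpa [etaProd] using (cf_lt_one ha).le.trans (by norm_num)
  | more i ih _ =>
    have h0 : (1 : ℝ) ≤ a i := by exact_mod_cast ha i
    have hm := cf_mem (a := drop (i + 1) a) fun _ => ha _
    have hp := etaProd_pos ha i
    have h2 : cf (drop i a) * cf (drop (i + 1) a) ≤ 1 / 2 := by
      have := cf_eq (a := drop i a) fun _ => ha _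
      rw [this, drop_drop, add_comm 1 i, drop_apply, zero_add, one_div_mul_eq_div,
        div_le_iff₀ (by linarith)]
      linarith [hm.2]
    rw [etaProd_succ, etaProd_succ, mul_assoc]
    calc etaProd i a * (cf (drop i a) * cf (drop (i + 1) a)) ≤ etaProd i a * (1 / 2) :=
          mul_le_mul_of_nonneg_left h2 hp.le
      _ ≤ 2 * (3 / 4) ^ i * (1 / 2) := by gcongr
      _ ≤ 2 * (3 / 4) ^ (i + 2) := by
          rw [pow_add]
          have : (0 : ℝ) < (3 / 4) ^ i := by positivity
          linarith

/-- With `q` and `q'` the denominators of two consecutive convergents, the product of the first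
`i` factors is `1 / (q + q' * t)`, where `t` is the value of the remaining continued fraction. -/
theorem exists_etaProd_mul_eq_one {a : ℕ → ℕ} (ha : ∀ i, 1 ≤ a i) (i : ℕ) :
    ∃ q q' : ℝ, 0 < q ∧ 0 ≤ q' ∧ q' ≤ q ∧ ∀ z : ℕ → ℕ, (∀ j, 1 ≤ z j) → (∀ j < i, z j = a j) →
      etaProd i z * (q + q' * cf (drop i z)) = 1 := by
  induction i with
  | zero => exact ⟨1, 0, one_pos, le_rfl, zero_le_one, fun z _ _ => by simp [etaProd]⟩
  | succ i ih =>
    obtain ⟨q, q', hq, hq', hle, h⟩ := ih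
    have h0 : (1 : ℝ) ≤ a i := by exact_mod_cast ha i
    refine ⟨q * a i + q', q, by positivity, hq.le, by nlinarith, fun z hz hza => ?_⟩
    have h1 := h z hz fun j hj => hza j (by omega)
    have h2 := cf_eq (a := drop i z) fun _ => hz _
    have hm := cf_pos (a := drop (i + 1) z) fun _ => hz _
    rw [drop_drop, add_comm 1 i, drop_apply, zero_add, hza i (by omega),
      eq_div_iff (by positivity)] at h2
    rw [etaProd_succ]
    linear_combination h1 + etaProd i z * q * h2

theorem etaProd_le_two_mul {a z : ℕ → ℕ} (ha : ∀ i, 1 ≤ a i) (hz : ∀ i, 1 ≤ z i) (i : ℕ)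
    (h : ∀ j < i, z j = a j) : etaProd i z ≤ 2 * etaProd i a := by
  obtain ⟨q, q', hq, hq', hle, H⟩ := exists_etaProd_mul_eq_one ha i
  have h1 := H z hz h
  have h2 := H a ha fun _ _ => rfl
  have p1 := etaProd_pos hz i
  have p2 := etaProd_pos ha i
  have m1 := cf_mem (a := drop i z) fun _ => hz _
  have m2 := cf_mem (a := drop i a) fun _ => ha _
  have e1 : etaProd i z * q ≤ 1 := by
    rw [← h1]
    exact mul_le_mul_of_nonneg_left (by nlinarith [m1.1]) p1.le
  have e2 : 1 ≤ 2 * etaProd i a * q := by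
    rw [← h2]
    nlinarith [mul_le_mul hle m2.2 m2.1 hq.le]
  exact le_of_mul_le_mul_right (e1.trans e2) hq

theorem neg_log_cf_le {a : ℕ → ℕ} (ha : ∀ i, 1 ≤ a i) : -Real.log (cf a) ≤ Real.log (a 0 + 1) := by
  have hm := cf_mem (a := drop 1 a) fun _ => ha _
  have h0 : (1 : ℝ) ≤ a 0 := by exact_mod_cast ha 0
  rw [← Real.log_inv, ← one_div, one_div_cf ha]
  exact Real.log_le_log (by linarith) (by linarith)

theorem le_neg_log_cf {a : ℕ → ℕ} (ha : ∀ i, 1 ≤ a i) : Real.log (a 0) ≤ -Real.log (cf a) := by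
  have hm := cf_mem (a := drop 1 a) fun _ => ha _
  have h0 : (1 : ℝ) ≤ a 0 := by exact_mod_cast ha 0
  rw [← Real.log_inv, ← one_div, one_div_cf ha]
  exact Real.log_le_log (by linarith) (by linarith)

theorem tendsto_cf_drop {a : ℕ → ℕ} {z : ℕ → ℕ → ℕ} (ha : ∀ i, 1 ≤ a i) (hz : ∀ n i, 1 ≤ z n i)
    (h : ∀ n i, i < n → z n i = a i) (j : ℕ) :
    Tendsto (fun n => cf (drop j (z n))) atTop (𝓝 (cf (drop j a))) := by
  rw [← tendsto_add_atTop_iff_nat (j + 1), tendsto_iff_dist_tendsto_zero]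
  refine squeeze_zero (fun _ => dist_nonneg) (fun n => ?_)
    (tendsto_pow_atTop_nhds_zero_of_lt_one (r := (1 / 2 : ℝ)) (by norm_num) (by norm_num))
  exact (close_cf (a := drop j (z _)) (b := drop j a) (fun _ => hz _ _) (fun _ => ha _) n
    fun i hi => h _ _ (by omega)).abs_sub_le (by positivity)
    (cf_lt_one fun _ => hz _ _).le (cf_lt_one fun _ => ha _).le

theorem tendsto_brjunoTerm {a : ℕ → ℕ} {z : ℕ → ℕ → ℕ} (ha : ∀ i, 1 ≤ a i)
    (hz : ∀ n i, 1 ≤ z n i) (h : ∀ n i, i < n → z n i = a i) (i : ℕ) :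
    Tendsto (fun n => brjunoTerm i (z n)) atTop (𝓝 (brjunoTerm i a)) :=
  (tendsto_finsetProd _ fun j _ => tendsto_cf_drop ha hz h j).mul
    ((tendsto_cf_drop ha hz h i).log (cf_pos fun _ => ha _).ne').neg

/-- The Brjuno function is lower semicontinuous along approximations by continued fractions. -/
theorem brjuno_cf_le_of_forall_le {a : ℕ → ℕ} {z : ℕ → ℕ → ℕ} (ha : ∀ i, 1 ≤ a i)
    (hz : ∀ n i, 1 ≤ z n i) (h : ∀ n i, i < n → z n i = a i) {y : ENNReal}
    (hy : ∀ n, brjuno (cf (z n)) ≤ y) : brjuno (cf a) ≤ y := by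
  rw [brjuno_cf ha, ENNReal.tsum_eq_iSup_sum]
  refine iSup_le fun s => le_of_tendsto' (tendsto_finsetSum s fun i _ =>
    ENNReal.tendsto_ofReal (tendsto_brjunoTerm ha hz h i)) fun n => ?_
  exact (ENNReal.sum_le_tsum s).trans ((brjuno_cf (hz n)).symm.trans_le (hy n))

/-- If `z n` starts with the first `n` partial quotients of `a`, continues with a partial quotient
that exceeds the one of `a` at most by one, and consists of ones from there on, then the values of
the Brjuno function converge. Up to the place `n`, the terms of the series for `z n` are dominated
by those for `a`; beyond it, the logarithms are bounded and the products decay exponentially. -/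
theorem tendsto_brjuno_cf {a : ℕ → ℕ} {z : ℕ → ℕ → ℕ} (ha : ∀ i, 1 ≤ a i)
    (hz : ∀ n i, 1 ≤ z n i) (h : ∀ n i, i < n → z n i = a i) (hn : ∀ n, z n n ≤ a n + 1)
    (h1 : ∀ n i, n < i → z n i = 1) (hfin : brjuno (cf a) ≠ ⊤) :
    Tendsto (fun n => brjuno (cf (z n))) atTop (𝓝 (brjuno (cf a))) := by
  set bound : ℕ → ℝ := fun i =>
    2 * Real.log 3 * etaProd i a + 2 * brjunoTerm i a + Real.log 2 * (2 * (3 / 4) ^ i)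
  have hsum := (brjuno_cf_ne_top_iff ha).1 hfin
  have hgeo : Summable fun i : ℕ => (2 * (3 / 4) ^ i : ℝ) :=
    (summable_geometric_of_lt_one (by norm_num) (by norm_num)).mul_left 2
  have hprod : Summable fun i => etaProd i a :=
    Summable.of_nonneg_of_le (fun i => (etaProd_pos ha i).le) (etaProd_le ha) hgeo
  have hbound : Summable bound :=
    ((hprod.mul_left _).add (hsum.mul_left 2)).add (hgeo.mul_left _)
  have l2 : 0 ≤ Real.log 2 := Real.log_nonneg (by norm_num)
  have l3 : 0 ≤ Real.log 3 := Real.log_nonneg (by norm_num)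
  have hle : ∀ n i, brjunoTerm i (z n) ≤ bound i := by
    intro n i
    have hp := etaProd_pos ha i
    have hb := brjunoTerm_nonneg ha i
    have hl := neg_log_cf_nonneg (a := drop i (z n)) fun _ => hz _ _
    have hgi : (0 : ℝ) < 2 * (3 / 4) ^ i := by positivity
    rcases le_or_gt i n with hi | hi
    · have hza : z n i ≤ a i + 1 := by
        rcases hi.lt_or_eq with hi | rfl
        · rw [h n i hi]; omega
        · exact hn i
      have e1 : -Real.log (cf (drop i (z n))) ≤ Real.log 3 + -Real.log (cf (drop i a)) := by
        have h0 : (1 : ℝ) ≤ a i := by exact_mod_cast ha i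
        have hza' : (z n i : ℝ) ≤ a i + 1 := by exact_mod_cast hza
        calc _ ≤ Real.log (z n i + 1) := by
              simpa using neg_log_cf_le (a := drop i (z n)) fun _ => hz _ _
          _ ≤ Real.log (3 * a i) := Real.log_le_log (by positivity) (by linarith)
          _ = Real.log 3 + Real.log (a i) := Real.log_mul (by norm_num) (by positivity)
          _ ≤ _ := by
              gcongr
              simpa using le_neg_log_cf (a := drop i a) fun _ => ha _
      have e2 := etaProd_le_two_mul ha (hz n) i fun j hj => h n j (by omega)
      calc brjunoTerm i (z n)
          ≤ 2 * etaProd i a * (Real.log 3 + -Real.log (cf (drop i a))) :=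
            mul_le_mul e2 e1 hl (by positivity)
        _ = 2 * Real.log 3 * etaProd i a + 2 * brjunoTerm i a := by rw [brjunoTerm]; ring
        _ ≤ bound i := le_add_of_nonneg_right (by positivity)
    · have e1 : -Real.log (cf (drop i (z n))) ≤ Real.log 2 := by
        have := neg_log_cf_le (a := drop i (z n)) fun _ => hz _ _
        rw [drop_apply, zero_add, h1 n i hi, Nat.cast_one, one_add_one_eq_two] at this
        exact this
      calc brjunoTerm i (z n) ≤ 2 * (3 / 4) ^ i * Real.log 2 :=
            mul_le_mul (etaProd_le (hz n) i) e1 hl hgi.le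
        _ = Real.log 2 * (2 * (3 / 4) ^ i) := mul_comm _ _
        _ ≤ bound i := le_add_of_nonneg_left (by positivity)
  have hlim := tendsto_tsum_of_dominated_convergence (𝓕 := atTop) hbound
    (tendsto_brjunoTerm ha hz h) (Eventually.of_forall fun n i => by
      rw [Real.norm_of_nonneg (brjunoTerm_nonneg (hz n) i)]
      exact hle n i)
  rw [brjuno_cf_eq_ofReal ha hsum]
  refine (ENNReal.tendsto_ofReal hlim).congr fun n => (brjuno_cf_eq_ofReal (hz n) ?_).symm
  exact Summable.of_nonneg_of_le (brjunoTerm_nonneg (hz n)) (hle n) hbound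

/-! ### Correctness of the rational bounds -/

theorem harmonicCode_spec {m : ℕ} (hm : 0 < m) (k : ℕ) :
    0 < (harmonicCode m k).2 ∧
      Real.log ((m + k) / m) ≤ (harmonicCode m k).1 / (harmonicCode m k).2 ∧
      ((harmonicCode m k).1 / (harmonicCode m k).2 : ℝ) ≤
        Real.log ((m + k) / m) + 1 / m - 1 / (m + k) := by
  have hm' : (0 : ℝ) < m := by exact_mod_cast hm
  induction k with
  | zero => simp [harmonicCode, hm'.ne']
  | succ k ih =>
    obtain ⟨h0, h1, h2⟩ := ih
    have h0' : (0 : ℝ) < (harmonicCode m k).2 := by exact_mod_cast h0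
    set r := harmonicCode m k with hr
    have hs : harmonicCode m (k + 1) = (r.1 * (m + k) + r.2, r.2 * (m + k)) := rfl
    have hmk : (0 : ℝ) < m + k := by positivity
    have hval : ((r.1 * (m + k) + r.2 : ℕ) / (r.2 * (m + k) : ℕ) : ℝ) =
        r.1 / r.2 + 1 / (m + k) := by
      push_cast
      field_simp
    have hlog : Real.log ((m + (k + 1 : ℕ)) / m) =
        Real.log ((m + k) / m) + Real.log ((m + k + 1) / (m + k)) := by
      rw [← Real.log_mul (by positivity) (by positivity)]
      congr 1
      push_cast
      field_simp
      ring
    have hu : Real.log ((m + k + 1) / (m + k) : ℝ) ≤ 1 / (m + k) := by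
      refine (Real.log_le_sub_one_of_pos (by positivity)).trans_eq ?_
      field_simp
      ring
    have hl : 1 / (m + k + 1 : ℝ) ≤ Real.log ((m + k + 1) / (m + k)) := by
      refine le_trans (le_of_eq ?_) (Real.one_sub_inv_le_log_of_pos (by positivity))
      field_simp
      ring
    rw [hs, hval, hlog]
    refine ⟨by positivity, by linarith, ?_⟩
    push_cast
    rw [← add_assoc (m : ℝ)]
    linarith

theorem logCode_spec {M p q : ℕ} (hM : 0 < M) (hq : 0 < q) (hpq : q ≤ p) :
    0 < (logCode M p q).2 ∧ Real.log (p / q) ≤ (logCode M p q).1 / (logCode M p q).2 ∧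
      ((logCode M p q).1 / (logCode M p q).2 : ℝ) ≤ Real.log (p / q) + 1 / M := by
  obtain ⟨h0, h1, h2⟩ := harmonicCode_spec (Nat.mul_pos hq hM) ((p - q) * M)
  have hM' : (0 : ℝ) < M := by exact_mod_cast hM
  have hq' : (1 : ℝ) ≤ q := by exact_mod_cast hq
  have hv : (((q * M : ℕ) : ℝ) + ((p - q) * M : ℕ)) / (q * M : ℕ) = p / q := by
    push_cast [Nat.cast_sub hpq]
    field_simp
    ring
  rw [hv] at h1 h2
  refine ⟨h0, h1, h2.trans ?_⟩
  have e1 : (0 : ℝ) ≤ 1 / (((q * M : ℕ) : ℝ) + ((p - q) * M : ℕ)) := by positivity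
  have e2 : (1 : ℝ) / (q * M : ℕ) ≤ 1 / M := by
    push_cast
    exact one_div_le_one_div_of_le hM' (by nlinarith)
  linarith

/-- The state `s` holds bounds for the number `x` and for the value `b` of the Brjuno function
at `x`, with errors that are small for large `M` as long as `k` is small compared to `M`. -/
structure Bounds (M k : ℕ) (s : BoundState) (x b : ℝ) : Prop where
  lower_num : 0 < s.1
  lower_den : 0 < s.2.1
  upper_den : 0 < s.2.2.2.1
  value_den : 0 < s.2.2.2.2.2
  lower_le : (s.1 / s.2.1 : ℝ) ≤ x
  le_upper : x ≤ s.2.2.1 / s.2.2.2.1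
  upper_le_one : (s.2.2.1 / s.2.2.2.1 : ℝ) ≤ 1
  upper_le : (s.2.2.1 / s.2.2.2.1 : ℝ) ≤ (1 + 1 / M) * (s.1 / s.2.1)
  le_value : b ≤ s.2.2.2.2.1 / s.2.2.2.2.2
  value_le : (s.2.2.2.2.1 / s.2.2.2.2.2 : ℝ) ≤ (1 + 1 / M) ^ (k + 2) * (b + (k + 4) * (2 / M))

/-- A relative error `e` in the argument is an absolute error at most `e` in the logarithm. -/
theorem log_le_add_of_le_mul {c h e : ℝ} (hc : 0 < c) (hh : 0 < h) (he : 0 ≤ e)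
    (hle : h ≤ (1 + e) * c) : Real.log h ≤ Real.log c + e := by
  have h1 := Real.log_le_log hh hle
  rw [Real.log_mul (by positivity) hc.ne'] at h1
  have h2 := Real.log_le_sub_one_of_pos (x := 1 + e) (by positivity)
  linarith

/-- The error of the upper bound `u` of the Brjuno function after a step, where `l` is the upper
bound of the logarithm `l'` and `lo` is the lower bound of `x`: the relative error grows by the
factor `1 + e`, and the absolute error by `2 * e`. -/
theorem value_step {a x lo u l l' b c e E : ℝ} (ha : 1 ≤ a) (hlo : 0 < lo) (hx : lo ≤ x)
    (hxlo : x ≤ (1 + e) * lo) (he : 0 ≤ e) (hu : 0 ≤ u) (hc : 0 ≤ c) (hE : 1 ≤ E)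
    (hub : u ≤ E * (b + c)) (hl : l ≤ l' + 2 * e) (hl' : 0 ≤ l') :
    l + u / (a + lo) ≤ (1 + e) * E * (l' + b / (a + x) + (c + 2 * e)) := by
  have hax : 1 ≤ a + x := by linarith
  have hae : 0 ≤ a * e := mul_nonneg (by linarith) he
  have i1 : u / (a + lo) ≤ (1 + e) * (u / (a + x)) := by
    rw [mul_div_assoc', div_le_div_iff₀ (by linarith) (by linarith)]
    have := mul_le_mul_of_nonneg_left
      (by linarith : a + x ≤ (1 + e) * (a + lo)) hu
    linarith
  have i2 : u / (a + x) ≤ E * (b / (a + x) + c) := by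
    have h1 : u / (a + x) ≤ E * (b + c) / (a + x) := by gcongr
    have h2 : c / (a + x) ≤ c := div_le_self hc hax
    calc _ ≤ E * (b + c) / (a + x) := h1
      _ = E * (b / (a + x) + c / (a + x)) := by ring
      _ ≤ _ := by gcongr
  have hE' : 1 ≤ (1 + e) * E := one_le_mul_of_one_le_of_one_le (by linarith) hE
  have i3 := mul_le_mul_of_nonneg_left i2 (by linarith : 0 ≤ 1 + e)
  have i4 := mul_le_mul_of_nonneg_right hE' (by linarith : 0 ≤ l' + 2 * e)
  linarith

theorem Bounds.step {M k : ℕ} {s : BoundState} {x b : ℝ} (hM : 0 < M) (h : Bounds M k s x b)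
    {a : ℕ} (ha : 1 ≤ a) :
    Bounds M (k + 1) (stepState M a s) (1 / (a + x)) (Real.log (a + x) + b / (a + x)) := by
  obtain ⟨lp, lq, hp, hq, up, uq⟩ := s
  obtain ⟨h1, h2, h3, h4, h5, h6, h7, h8, h9, h10⟩ := h
  dsimp only at *
  have hM' : (0 : ℝ) < M := by exact_mod_cast hM
  have ha' : (1 : ℝ) ≤ a := by exact_mod_cast ha
  have h1' : (0 : ℝ) < lp := by exact_mod_cast h1
  have h2' : (0 : ℝ) < lq := by exact_mod_cast h2
  have h3' : (0 : ℝ) < hq := by exact_mod_cast h3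
  have h4' : (0 : ℝ) < uq := by exact_mod_cast h4
  have hlogle : hq ≤ a * hq + hp :=
    (Nat.le_mul_of_pos_left hq ha).trans (Nat.le_add_right _ _)
  obtain ⟨l0, l1, l2⟩ := logCode_spec hM h3 hlogle
  set L := logCode M (a * hq + hp) hq with hL
  have l0' : (0 : ℝ) < L.2 := by exact_mod_cast l0
  have hs : stepState M a (lp, lq, hp, hq, up, uq) = (hq, a * hq + hp, lq, a * lq + lp,
    L.1 * (uq * (a * lq + lp)) + up * lq * L.2, L.2 * (uq * (a * lq + lp))) := rfl
  rw [hs]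
  have elo : ((lq : ℕ) / (a * lq + lp : ℕ) : ℝ) = 1 / (a + lp / lq) := by
    push_cast; field_simp
  have ehi : ((hq : ℕ) / (a * hq + hp : ℕ) : ℝ) = 1 / (a + hp / hq) := by
    have : (0 : ℝ) ≤ hp := by positivity
    push_cast; field_simp
  have elog : ((a * hq + hp : ℕ) / hq : ℝ) = a + hp / hq := by
    push_cast; field_simp
  have eu : ((L.1 * (uq * (a * lq + lp)) + up * lq * L.2 : ℕ) /
      (L.2 * (uq * (a * lq + lp)) : ℕ) : ℝ) = L.1 / L.2 + (up / uq) / (a + lp / lq) := by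
    push_cast; field_simp
  rw [elog] at l1 l2
  have hlo0 : (0 : ℝ) < lp / lq := by positivity
  have hu0 : (0 : ℝ) ≤ up / uq := by positivity
  set lo : ℝ := lp / lq
  set hi : ℝ := hp / hq
  set u : ℝ := up / uq
  set l : ℝ := L.1 / L.2
  set e : ℝ := 1 / M with he
  have he0 : 0 < e := by positivity
  have h2e : (2 / M : ℝ) = 2 * e := by rw [he]; ring
  rw [h2e] at h10
  have hx0 : 0 < x := by linarith
  have hxlo : x ≤ (1 + e) * lo := by linarith
  have hae : e ≤ a * e := le_mul_of_one_le_left he0.le ha'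
  have hlt : lo * e ≤ e := mul_le_of_le_one_left he0.le (by linarith)
  have hxe : lo * e ≤ x * e := by gcongr
  have hlx : Real.log (a + x) ≤ Real.log (a + hi) := Real.log_le_log (by linarith) (by linarith)
  have hlx0 : 0 ≤ Real.log (a + x) := Real.log_nonneg (by linarith)
  have hlh : Real.log (a + hi) ≤ Real.log (a + x) + e :=
    log_le_add_of_le_mul (by linarith) (by linarith) he0.le (by linarith)
  refine ⟨h3, ?_, ?_, ?_, ?_, ?_, ?_, ?_, ?_, ?_⟩ <;> dsimp only
  · exact h3.trans_le hlogle
  · exact Nat.add_pos_right _ h1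
  · exact Nat.mul_pos l0 (Nat.mul_pos h4 (Nat.add_pos_right _ h1))
  · rw [ehi]
    exact one_div_le_one_div_of_le (by linarith) (by linarith)
  · rw [elo]
    exact one_div_le_one_div_of_le (by linarith) (by linarith)
  · rw [elo, div_le_one (by linarith)]
    linarith
  · rw [elo, ehi, mul_one_div, div_le_div_iff₀ (by linarith) (by linarith)]
    linarith
  · rw [eu]
    refine add_le_add (hlx.trans l1) (div_le_div₀ hu0 h9 (by linarith) (by linarith))
  · rw [eu, h2e]
    have e1 : (1 + e) ^ (k + 1 + 2) = (1 + e) * (1 + e) ^ (k + 2) := by ring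
    have := value_step (E := (1 + e) ^ (k + 2)) (c := (k + 4) * (2 * e)) ha' hlo0 h5 hxlo he0.le hu0
      (by positivity) (one_le_pow₀ (by linarith)) h10
      (by linarith : l ≤ Real.log (a + x) + 2 * e) hlx0
    rw [e1]
    push_cast
    linarith

theorem bounds_base {M : ℕ} (hM : 0 < M) (hfin : brjuno (cf fun _ => 1) ≠ ⊤) :
    Bounds M 0 (baseState M) (cf fun _ => 1) (brjuno (cf fun _ => 1)).toReal := by
  have hM' : (0 : ℝ) < M := by exact_mod_cast hM
  have hpos : ∀ i, 1 ≤ (fun _ : ℕ => 1) i := fun _ => le_rfl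
  have hrec : (brjuno (cf fun _ => 1)).toReal = _ := toReal_brjuno_cf hpos hfin
  have hw := cf_eq hpos
  have hd : drop 1 (fun _ => 1) = fun _ => 1 := rfl
  rw [hd] at hw hrec
  have hw0 := cf_pos hpos
  have hw1 := cf_lt_one hpos
  have hwv := cf_one
  set w := cf fun _ => 1
  set b := (brjuno w).toReal
  rw [Nat.cast_one] at hw hrec
  have hw2 : w ^ 2 = 1 - w := by
    rw [eq_div_iff (by positivity)] at hw
    linarith
  -- The recursion at the fixed point `w` determines the finite value `b`.
  have hb : b * w ^ 2 = Real.log (1 + w) := by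
    have : b / (1 + w) = b * w := by
      rw [div_eq_iff (by positivity)]
      linear_combination -b * hw2
    rw [this] at hrec
    rw [hw2]
    linarith
  set r := Nat.sqrt (5 * (M * M)) with hr
  have r0 : 2 * M ≤ r := Nat.le_sqrt.2 (by nlinarith)
  have r1 : r * r ≤ 5 * (M * M) := Nat.sqrt_le _
  have r2 : 5 * (M * M) < (r + 1) * (r + 1) := Nat.lt_succ_sqrt _
  have r3 : r < 3 * M := Nat.sqrt_lt.2 (by nlinarith)
  have r0' : (2 : ℝ) * M ≤ r := by exact_mod_cast r0
  have r1' : (r : ℝ) * r ≤ 5 * (M * M) := by exact_mod_cast r1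
  have r2' : 5 * (M * M : ℝ) < (r + 1) * (r + 1) := by exact_mod_cast r2
  have r3' : (r : ℝ) + 1 ≤ 3 * M := by exact_mod_cast r3
  have s5 : Real.sqrt 5 ^ 2 = 5 := Real.sq_sqrt (by norm_num)
  have hlow : (r : ℝ) ≤ Real.sqrt 5 * M := by
    rw [← sq_le_sq₀ (by positivity) (by positivity), mul_pow, s5]
    linarith
  have hupp : Real.sqrt 5 * M ≤ r + 1 := by
    rw [← sq_le_sq₀ (by positivity) (by positivity), mul_pow, s5]
    linarith
  have hq2 : 0 < 2 * M := by omega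
  obtain ⟨l0, l1, l2⟩ := logCode_spec hM hq2 (Nat.le_add_right (2 * M) (r + 1 - M))
  set L := logCode M (2 * M + (r + 1 - M)) (2 * M) with hL
  have l0' : (0 : ℝ) < L.2 := by exact_mod_cast l0
  have hs : baseState M = (r - M, 2 * M, r + 1 - M, 2 * M, L.1 * ((2 * M) * (2 * M)),
    L.2 * ((r - M) * (r - M))) := rfl
  rw [hs]
  have elo : ((r - M : ℕ) / (2 * M : ℕ) : ℝ) = (r - M) / (2 * M) := by
    push_cast [Nat.cast_sub (by omega : M ≤ r)]
    rfl
  have ehi : ((r + 1 - M : ℕ) / (2 * M : ℕ) : ℝ) = (r - M) / (2 * M) + 1 / (2 * M) := by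
    push_cast [Nat.cast_sub (by omega : M ≤ r + 1)]
    ring
  have elog : ((2 * M + (r + 1 - M) : ℕ) / (2 * M : ℕ) : ℝ) =
      1 + ((r - M) / (2 * M) + 1 / (2 * M)) := by
    push_cast [Nat.cast_sub (by omega : M ≤ r + 1)]
    field_simp
    ring
  have hlo2 : (1 : ℝ) / 2 ≤ (r - M) / (2 * M) := by
    rw [div_le_div_iff₀ (by norm_num) (by positivity)]
    linarith
  have hrM : (0 : ℝ) < r - M := by linarith
  have eu : ((L.1 * ((2 * M) * (2 * M)) : ℕ) / (L.2 * ((r - M) * (r - M)) : ℕ) : ℝ) =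
      L.1 / L.2 / ((r - M) / (2 * M)) ^ 2 := by
    push_cast [Nat.cast_sub (by omega : M ≤ r)]
    field_simp
  have hlow' : ((r - M) / (2 * M) : ℝ) ≤ w := by
    rw [hwv, div_le_div_iff₀ (by positivity) (by norm_num)]
    linarith
  have hupp' : w ≤ (r - M) / (2 * M) + 1 / (2 * M) := by
    rw [hwv, ← add_div, div_le_div_iff₀ (by norm_num) (by positivity)]
    linarith
  have hone : ((r - M) / (2 * M) + 1 / (2 * M) : ℝ) ≤ 1 := by
    rw [← add_div, div_le_one (by positivity)]
    linarith
  rw [elog] at l1 l2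
  have hhalf : (1 / (2 * M) : ℝ) = 1 / M / 2 := by
    field_simp
  have h2e : (2 / M : ℝ) = 2 * (1 / M) := by ring
  have he0 : (0 : ℝ) < 1 / M := by positivity
  rw [hhalf] at ehi l1 l2 hupp' hone
  set lo : ℝ := (r - M) / (2 * M)
  set l : ℝ := L.1 / L.2
  set e : ℝ := 1 / M
  have hele : e / 2 ≤ e * lo := by
    have := mul_le_mul_of_nonneg_left hlo2 he0.le
    linarith
  have hlx : Real.log (1 + w) ≤ Real.log (1 + (lo + e / 2)) :=
    Real.log_le_log (by linarith) (by linarith)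
  have hlh : Real.log (1 + (lo + e / 2)) ≤ Real.log (1 + w) + e :=
    log_le_add_of_le_mul (by linarith) (by linarith) he0.le (by linarith [mul_pos he0 hw0])
  have hb0 : 0 ≤ b := ENNReal.toReal_nonneg
  refine ⟨?_, hq2, hq2, ?_, ?_, ?_, ?_, ?_, ?_, ?_⟩ <;> dsimp only
  · omega
  · have : 0 < r - M := by omega
    positivity
  · rwa [elo]
  · rwa [ehi]
  · rwa [ehi]
  · rw [elo, ehi]
    linarith
  · rw [eu, le_div_iff₀ (by positivity)]
    calc b * lo ^ 2 ≤ b * w ^ 2 := by gcongr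
      _ ≤ l := by linarith
  · rw [eu, h2e, div_le_iff₀ (by positivity)]
    have hw4 : 1 ≤ 4 * w ^ 2 := by
      have := pow_le_pow_left₀ (by norm_num) (hlo2.trans hlow') 2
      linarith
    have hwlo : w ^ 2 ≤ ((1 + e) * lo) ^ 2 := by
      gcongr
      linarith
    calc l ≤ b * w ^ 2 + 2 * e := by linarith
      _ ≤ b * w ^ 2 + 2 * e * (4 * w ^ 2) := by
          have := le_mul_of_one_le_right (by positivity : 0 ≤ 2 * e) hw4
          linarith
      _ = (b + 4 * (2 * e)) * w ^ 2 := by ring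
      _ ≤ (b + 4 * (2 * e)) * ((1 + e) * lo) ^ 2 := by gcongr
      _ = _ := by push_cast; ring

/-- The digits in `I` followed by ones. -/
def extendByOnes (I : List ℕ) : ℕ → ℕ := fun i => I.getD i 1

theorem one_le_extendByOnes {I : List ℕ} (hI : ∀ c ∈ I, 1 ≤ c) (i : ℕ) :
    1 ≤ extendByOnes I i := by
  rw [extendByOnes, List.getD_eq_getElem?_getD]
  rcases lt_or_ge i I.length with h | h
  · rw [List.getElem?_eq_getElem h]
    exact hI _ (List.getElem_mem h)
  · rw [List.getElem?_eq_none h]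
    rfl

theorem brjuno_extendByOnes_ne_top (hfin : brjuno (cf fun _ => 1) ≠ ⊤) {I : List ℕ}
    (hI : ∀ c ∈ I, 1 ≤ c) : brjuno (cf (extendByOnes I)) ≠ ⊤ := by
  induction I with
  | nil => exact hfin
  | cons c I ih =>
    exact brjuno_cf_ne_top_of_drop (one_le_extendByOnes hI)
      (ih fun d hd => hI d (List.mem_cons_of_mem _ hd))

theorem bounds_listState (hfin : brjuno (cf fun _ => 1) ≠ ⊤) {M : ℕ} (hM : 0 < M) {I : List ℕ}
    (hI : ∀ c ∈ I, 1 ≤ c) : Bounds M I.length (listState M I) (cf (extendByOnes I))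
      (brjuno (cf (extendByOnes I))).toReal := by
  induction I with
  | nil => exact bounds_base hM hfin
  | cons c I ih =>
    have hI' : ∀ d ∈ I, 1 ≤ d := fun d hd => hI d (List.mem_cons_of_mem _ hd)
    have h := (ih hI').step hM (hI c List.mem_cons_self)
    rw [toReal_brjuno_cf (one_le_extendByOnes hI) (brjuno_extendByOnes_ne_top hfin hI'),
      cf_eq (one_le_extendByOnes hI)]
    exact h

/-! ### The greedy choice of digits -/

/-- The positive digits encoded by a list of natural numbers: each entry raised by one. -/
def toDigits (J : List ℕ) : List ℕ := J.map Nat.succ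

theorem one_le_of_mem_toDigits {J : List ℕ} : ∀ c ∈ toDigits J, 1 ≤ c := by
  simp [toDigits]

theorem exceeds_iff {s : BoundState} (hs : 0 < s.2.2.2.2.2) (c : ℕ × ℕ × ℕ) :
    exceeds s c = true ↔ dyadic c < s.2.2.2.2.1 / s.2.2.2.2.2 := by
  have hs' : (0 : ℝ) < s.2.2.2.2.2 := by exact_mod_cast hs
  rw [exceeds, decide_eq_true_iff, dyadic, div_lt_div_iff₀ (by positivity) hs', sub_mul,
    sub_lt_iff_lt_add]
  exact_mod_cast Iff.rfl

/-- A large digit makes the Brjuno function large, even after other digits. -/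
theorem exists_log_le_mul_brjuno (hfin : brjuno (cf fun _ => 1) ≠ ⊤) (J : List ℕ) :
    ∃ K : ℝ, 0 < K ∧ ∀ m : ℕ, Real.log (m + 1) ≤
      K * (brjuno (cf (extendByOnes (toDigits (J ++ [m]))))).toReal := by
  induction J with
  | nil =>
    refine ⟨1, one_pos, fun m => ?_⟩
    have hpos := one_le_extendByOnes (one_le_of_mem_toDigits (J := [m]))
    have hd : drop 1 (extendByOnes (toDigits [m])) = fun _ => 1 := rfl
    have hw := cf_pos (a := fun _ => 1) fun _ => le_rfl
    have h0 : extendByOnes (toDigits [m]) 0 = m + 1 := rfl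
    rw [List.nil_append, toReal_brjuno_cf hpos (by rwa [hd]), hd, h0, one_mul]
    push_cast
    refine (Real.log_le_log (by positivity) (by linarith)).trans (le_add_of_nonneg_right ?_)
    have := ENNReal.toReal_nonneg (a := brjuno (cf fun _ => 1))
    positivity
  | cons c J ih =>
    obtain ⟨K, hK, h⟩ := ih
    refine ⟨K * (c + 2), by positivity, fun m => (h m).trans ?_⟩
    have hpos := one_le_extendByOnes (one_le_of_mem_toDigits (J := c :: (J ++ [m])))
    have hposd := one_le_extendByOnes (one_le_of_mem_toDigits (J := J ++ [m]))
    have hd : drop 1 (extendByOnes (toDigits (c :: (J ++ [m])))) =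
      extendByOnes (toDigits (J ++ [m])) := rfl
    have h0 : extendByOnes (toDigits (c :: (J ++ [m]))) 0 = c + 1 := rfl
    rw [List.cons_append, toReal_brjuno_cf hpos
      (by rw [hd]; exact brjuno_extendByOnes_ne_top hfin one_le_of_mem_toDigits), hd, h0, mul_assoc]
    have hx := cf_mem hposd
    set x := cf (extendByOnes (toDigits (J ++ [m])))
    have hb := ENNReal.toReal_nonneg (a := brjuno x)
    set b := (brjuno x).toReal
    push_cast
    have hl : 0 ≤ Real.log (c + 1 + x) := Real.log_nonneg (by linarith [hx.1])
    have hbd : b ≤ (c + 2) * (b / (c + 1 + x)) := by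
      rw [mul_div_assoc', le_div_iff₀ (by linarith [hx.1]), mul_comm]
      exact mul_le_mul_of_nonneg_right (by linarith [hx.2]) hb
    refine mul_le_mul_of_nonneg_left (hbd.trans ?_) hK.le
    exact mul_le_mul_of_nonneg_left (by linarith) (by positivity)

theorem exists_exceeds (hfin : brjuno (cf fun _ => 1) ≠ ⊤) {M : ℕ} (hM : 0 < M) (J : List ℕ)
    (c : ℕ × ℕ × ℕ) : ∃ m, exceeds (listState M (toDigits (J ++ [m + 1]))) c = true := by
  obtain ⟨K, hK, h⟩ := exists_log_le_mul_brjuno hfin J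
  -- The digit has to satisfy `log m > K * c`.
  refine ⟨⌈Real.exp (K * dyadic c)⌉₊, ?_⟩
  set m := ⌈Real.exp (K * dyadic c)⌉₊ with hm
  have hb := bounds_listState hfin hM (one_le_of_mem_toDigits (J := J ++ [m + 1]))
  rw [exceeds_iff hb.value_den]
  refine lt_of_lt_of_le ?_ hb.le_value
  refine lt_of_mul_lt_mul_left (lt_of_lt_of_le ?_ (h (m + 1))) hK.le
  have h1 : Real.exp (K * dyadic c) ≤ m := Nat.le_ceil _
  rw [Real.lt_log_iff_exp_lt (by positivity)]
  push_cast
  linarith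

/-- The list built by appending `f (n, J)` to the list `J` at stage `n`. -/
def greedyList (f : ℕ × List ℕ → ℕ) (n : ℕ) : List ℕ :=
  Nat.rec [] (fun n J => J ++ [f (n, J)]) n

theorem greedyList_succ (f : ℕ × List ℕ → ℕ) (n : ℕ) :
    greedyList f (n + 1) = greedyList f n ++ [f (n, greedyList f n)] := rfl

theorem computable_greedyList {f : ℕ × List ℕ → ℕ} (hf : Computable f) :
    Computable (greedyList f) := by
  refine Computable.nat_rec (f := fun n : ℕ => n) (g := fun _ => ([] : List ℕ))
    (h := fun _ r => r.2 ++ [f (r.1, r.2)]) Computable.id (Computable.const _) ?_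
  exact (Computable.list_concat.comp (Computable.snd.comp Computable.snd)
    (hf.comp Computable.snd)).to₂

theorem length_greedyList (f : ℕ × List ℕ → ℕ) (n : ℕ) : (greedyList f n).length = n := by
  induction n with
  | zero => rfl
  | succ n ih => rw [greedyList_succ, List.length_append, ih, List.length_singleton]

/-- The infinite sequence of positive digits encoded by the lists `greedyList f n`. -/
def greedySeq (f : ℕ × List ℕ → ℕ) (n : ℕ) : ℕ := f (n, greedyList f n) + 1

theorem one_le_greedySeq (f : ℕ × List ℕ → ℕ) (n : ℕ) : 1 ≤ greedySeq f n := Nat.le_add_left _ _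

theorem extendByOnes_append_lt {I I' : List ℕ} {i : ℕ} (hi : i < I.length) :
    extendByOnes (I ++ I') i = extendByOnes I i := by
  simp only [extendByOnes, List.getD_eq_getElem?_getD, List.getElem?_append_left hi]

theorem extendByOnes_of_length_le {I : List ℕ} {i : ℕ} (hi : I.length ≤ i) :
    extendByOnes I i = 1 := by
  simp [extendByOnes, List.getD_eq_getElem?_getD, List.getElem?_eq_none hi]

theorem extendByOnes_append_length (I : List ℕ) (c : ℕ) :
    extendByOnes (I ++ [c]) I.length = c := by
  simp [extendByOnes, List.getD_eq_getElem?_getD]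

theorem extendByOnes_append_one (I : List ℕ) : extendByOnes (I ++ [1]) = extendByOnes I := by
  ext i
  rcases lt_trichotomy i I.length with h | rfl | h
  · exact extendByOnes_append_lt h
  · rw [extendByOnes_append_length, extendByOnes_of_length_le le_rfl]
  · rw [extendByOnes_of_length_le (by simpa using h), extendByOnes_of_length_le h.le]

theorem length_toDigits_greedyList (f : ℕ × List ℕ → ℕ) (n : ℕ) :
    (toDigits (greedyList f n)).length = n := by
  rw [toDigits, List.length_map, length_greedyList]

theorem toDigits_append (J : List ℕ) (m : ℕ) : toDigits (J ++ [m]) = toDigits J ++ [m + 1] := by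
  simp [toDigits]

theorem extendByOnes_greedyList {f : ℕ × List ℕ → ℕ} {n i : ℕ} (hi : i < n) :
    extendByOnes (toDigits (greedyList f n)) i = greedySeq f i := by
  induction n with
  | zero => omega
  | succ n ih =>
    have hl := length_toDigits_greedyList f n
    rw [greedyList_succ, toDigits_append]
    rcases Nat.lt_succ_iff_lt_or_eq.1 hi with h | rfl
    · rw [extendByOnes_append_lt (by omega), ih h]
    · have := extendByOnes_append_length (toDigits (greedyList f i)) (f (i, greedyList f i) + 1)
      rwa [hl] at this

/-- A continued fraction with a computable sequence of partial quotients is a computable number: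
the lower bounds of its finite parts are rounded down to dyadic numbers. -/
theorem isComputableReal_cf_greedySeq (hfin : brjuno (cf fun _ => 1) ≠ ⊤) {f : ℕ × List ℕ → ℕ}
    (hf : Computable f) : IsComputableReal (cf (greedySeq f)) := by
  set S : ℕ → BoundState := fun n =>
    listState (2 ^ (n + 2)) (toDigits (greedyList f (n + 3))) with hS
  have hpow : Computable fun n : ℕ => 2 ^ (n + 2) :=
    primrec_two_pow.to_comp.comp (Primrec.nat_add.comp .id (Primrec.const 2)).to_comp
  have hSc : Computable S := primrec₂_listState.to_comp.comp hpow
    ((Primrec.list_map .id (Primrec.succ.comp Primrec.snd).to₂).to_comp.comp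
      ((computable_greedyList hf).comp (Primrec.nat_add.comp .id (Primrec.const 3)).to_comp))
  refine ⟨fun n => ((S n).1 * 2 ^ (n + 2) / (S n).2.1, 0, n + 2), ?_, fun n => ?_⟩
  · exact (Primrec.nat_div.to_comp.comp
      (Primrec.nat_mul.to_comp.comp (Computable.fst.comp hSc) hpow)
      (Computable.fst.comp (Computable.snd.comp hSc))).pair
      ((Computable.const 0).pair (Primrec.nat_add.comp .id (Primrec.const 2)).to_comp)
  have hb := bounds_listState hfin (M := 2 ^ (n + 2)) (by positivity)
    (one_le_of_mem_toDigits (J := greedyList f (n + 3)))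
  rw [show listState (2 ^ (n + 2)) (toDigits (greedyList f (n + 3))) = S n from rfl] at hb
  have h1 := hb.lower_le
  have h2 := hb.le_upper.trans hb.upper_le
  have hlp := hb.lower_den
  have hclose := (close_cf (one_le_greedySeq f)
    (one_le_extendByOnes (one_le_of_mem_toDigits (J := greedyList f (n + 3)))) (n + 2)
    fun i hi => (extendByOnes_greedyList (by omega)).symm).abs_sub_le (by positivity)
    (cf_lt_one (one_le_greedySeq f)).le (cf_lt_one (one_le_extendByOnes one_le_of_mem_toDigits)).le
  have hone := (cf_lt_one (one_le_extendByOnes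
    (one_le_of_mem_toDigits (J := greedyList f (n + 3))))).le
  have hdy : dyadic ((S n).1 * 2 ^ (n + 2) / (S n).2.1, 0, n + 2) ≤ (S n).1 / (S n).2.1 ∧
      ((S n).1 / (S n).2.1 : ℝ) < dyadic ((S n).1 * 2 ^ (n + 2) / (S n).2.1, 0, n + 2) +
        (1 / 2) ^ (n + 2) := by
    have hd : (0 : ℝ) < (S n).2.1 := by exact_mod_cast hlp
    have e1 := Nat.div_mul_le_self ((S n).1 * 2 ^ (n + 2)) (S n).2.1
    have e2 := Nat.lt_div_mul_add (a := (S n).1 * 2 ^ (n + 2)) hlp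
    set v := (S n).1 * 2 ^ (n + 2) / (S n).2.1
    have e1' : (v * (S n).2.1 : ℝ) ≤ (S n).1 * 2 ^ (n + 2) := by exact_mod_cast e1
    have e2' : ((S n).1 * 2 ^ (n + 2) : ℝ) < v * (S n).2.1 + (S n).2.1 := by exact_mod_cast e2
    simp only [dyadic, Nat.cast_zero, sub_zero]
    constructor
    · rw [div_le_div_iff₀ (by positivity) hd]
      exact e1'
    · rw [one_div, inv_pow, ← one_div, ← add_div, div_lt_div_iff₀ hd (by positivity)]
      linarith
  set v := dyadic ((S n).1 * 2 ^ (n + 2) / (S n).2.1, 0, n + 2)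
  set lo : ℝ := (S n).1 / (S n).2.1
  rw [abs_le] at hclose
  have hM : (1 / (2 ^ (n + 2) : ℕ) : ℝ) = (1 / 2) ^ (n + 2) := by
    rw [one_div_pow]
    push_cast
    rfl
  rw [hM, add_mul, one_mul] at h2
  have hE : (1 / 2 : ℝ) ^ (n + 2) = 1 / 2 ^ n / 4 := by
    rw [pow_add, one_div_pow]
    norm_num
    ring
  have hE0 : (0 : ℝ) < 1 / 2 ^ n := by positivity
  rw [hE] at hclose h2 hdy
  have h3 : 1 / 2 ^ n / 4 * lo ≤ 1 / 2 ^ n / 4 :=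
    mul_le_of_le_one_right (by positivity) (h1.trans hone)
  rw [abs_lt]
  constructor <;> linarith [hdy.1, hdy.2]

/-- The relative and the absolute error of the upper bounds vanish in the limit, when the precision
is `2 ^ (-n)` and the number of digits grows linearly. -/
theorem tendsto_value_bound {b : ℕ → ℝ} {l : ℝ} (hb : Tendsto b atTop (𝓝 l)) :
    Tendsto (fun n : ℕ => (1 + 1 / (2 ^ n : ℝ)) ^ (n + 3) * (b n + (n + 5) * (2 / 2 ^ n)))
      atTop (𝓝 l) := by
  have h1 : Tendsto (fun n : ℕ => (n : ℝ) / 2 ^ n) atTop (𝓝 0) := by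
    simpa using tendsto_pow_const_div_const_pow_of_one_lt 1 (one_lt_two (α := ℝ))
  have h0 : Tendsto (fun n : ℕ => (1 : ℝ) / 2 ^ n) atTop (𝓝 0) := by
    simpa using tendsto_pow_const_div_const_pow_of_one_lt 0 (one_lt_two (α := ℝ))
  have h2 : Tendsto (fun n : ℕ => ((n : ℝ) + 5) * (2 / 2 ^ n)) atTop (𝓝 0) := by
    have := (h1.const_mul 2).add (h0.const_mul 10)
    rw [mul_zero, mul_zero, add_zero] at this
    exact this.congr fun n => by ring
  have h3 : Tendsto (fun n : ℕ => Real.exp ((n : ℝ) / 2 ^ n + 3 * (1 / 2 ^ n))) atTop (𝓝 1) := by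
    have := (h1.add (h0.const_mul 3)).rexp
    rwa [mul_zero, add_zero, Real.exp_zero] at this
  have h4 : Tendsto (fun n : ℕ => (1 + 1 / (2 ^ n : ℝ)) ^ (n + 3)) atTop (𝓝 1) := by
    refine tendsto_of_tendsto_of_tendsto_of_le_of_le tendsto_const_nhds h3
      (fun n => one_le_pow₀ (le_add_of_nonneg_right (by positivity))) fun n => ?_
    calc (1 + 1 / (2 ^ n : ℝ)) ^ (n + 3) ≤ Real.exp (1 / 2 ^ n) ^ (n + 3) := by
          gcongr
          linarith [Real.add_one_le_exp (1 / (2 ^ n : ℝ))]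
      _ = Real.exp ((n : ℝ) / 2 ^ n + 3 * (1 / 2 ^ n)) := by
          rw [← Real.exp_nat_mul]
          congr 1
          push_cast
          ring
  have := h4.mul (hb.add h2)
  rwa [add_zero, one_mul] at this

/-- The greedy algorithm: at stage `n`, the least digit is appended for which the next larger digit
would make the upper bound of the Brjuno function exceed the `n`-th dyadic number `c n`. -/
theorem exists_computable_greedy (hfin : brjuno (cf fun _ => 1) ≠ ⊤) {c : ℕ → ℕ × ℕ × ℕ}
    (hc : Computable c) : ∃ f : ℕ × List ℕ → ℕ, Computable f ∧ ∀ n J,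
      exceeds (listState (2 ^ n) (toDigits (J ++ [f (n, J) + 1]))) (c n) = true ∧
      ∀ m < f (n, J), exceeds (listState (2 ^ n) (toDigits (J ++ [m + 1]))) (c n) = false := by
  have hp : Computable₂ fun (x : ℕ × List ℕ) (m : ℕ) =>
      exceeds (listState (2 ^ x.1) (toDigits (x.2 ++ [m + 1]))) (c x.1) := by
    have hn : Computable fun z : (ℕ × List ℕ) × ℕ => z.1.1 := Computable.fst.comp Computable.fst
    have hl : Computable fun z : (ℕ × List ℕ) × ℕ => toDigits (z.1.2 ++ [z.2 + 1]) :=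
      (Primrec.list_map (Primrec.list_concat.comp (Primrec.snd.comp Primrec.fst)
        (Primrec.succ.comp Primrec.snd)) (Primrec.succ.comp Primrec.snd).to₂).to_comp
    exact (primrec₂_exceeds.to_comp.comp
      (primrec₂_listState.to_comp.comp (primrec_two_pow.to_comp.comp hn) hl) (hc.comp hn)).to₂
  obtain ⟨f, hf, h⟩ := exists_computable_least hp fun x =>
    exists_exceeds hfin (by positivity) x.2 (c x.1)
  exact ⟨f, hf, fun n J => h (n, J)⟩

/-- The greedy algorithm never overshoots: a digit one does not change the value of the Brjuno
function, and a larger digit is used only if the upper bound is at most the target. -/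
theorem brjuno_greedyList_le (hfin : brjuno (cf fun _ => 1) ≠ ⊤) {y : ℝ}
    (hle : brjuno (cf fun _ => 1) ≤ ENNReal.ofReal y) {c : ℕ → ℕ × ℕ × ℕ}
    (hcy : ∀ n, dyadic (c n) ≤ y) {f : ℕ × List ℕ → ℕ}
    (hf : ∀ n J, ∀ m < f (n, J),
      exceeds (listState (2 ^ n) (toDigits (J ++ [m + 1]))) (c n) = false) (n : ℕ) :
    brjuno (cf (extendByOnes (toDigits (greedyList f n)))) ≤ ENNReal.ofReal y := by
  induction n with
  | zero => exact hle
  | succ n ih =>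
    rw [greedyList_succ]
    have hfn := hf n (greedyList f n)
    rcases hm : f (n, greedyList f n) with _ | m
    · rw [toDigits_append, zero_add, extendByOnes_append_one]
      exact ih
    · have hex := hfn m (by omega)
      have hb := bounds_listState hfin (M := 2 ^ n) (by positivity)
        (one_le_of_mem_toDigits (J := greedyList f n ++ [m + 1]))
      rw [← Bool.not_eq_true, exceeds_iff hb.value_den, not_lt] at hex
      rw [← ENNReal.ofReal_toReal (brjuno_extendByOnes_ne_top hfin one_le_of_mem_toDigits)]
      exact ENNReal.ofReal_le_ofReal ((hb.le_value.trans hex).trans (hcy n))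

/-- The greedy algorithm reaches its target. -/
theorem brjuno_cf_greedySeq (hfin : brjuno (cf fun _ => 1) ≠ ⊤) {y : ℝ}
    (hle : brjuno (cf fun _ => 1) ≤ ENNReal.ofReal y) {c : ℕ → ℕ × ℕ × ℕ}
    (hmono : Monotone fun n => dyadic (c n))
    (hlim : Tendsto (fun n => dyadic (c n)) atTop (𝓝 y)) {f : ℕ × List ℕ → ℕ}
    (hf : ∀ n J, exceeds (listState (2 ^ n) (toDigits (J ++ [f (n, J) + 1]))) (c n) = true ∧
      ∀ m < f (n, J), exceeds (listState (2 ^ n) (toDigits (J ++ [m + 1]))) (c n) = false) :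
    brjuno (cf (greedySeq f)) = ENNReal.ofReal y := by
  have ha := one_le_greedySeq f
  have hupper : brjuno (cf (greedySeq f)) ≤ ENNReal.ofReal y :=
    brjuno_cf_le_of_forall_le ha (fun n => one_le_extendByOnes one_le_of_mem_toDigits)
      (fun n i hi => extendByOnes_greedyList hi)
      (brjuno_greedyList_le hfin hle (fun n => hmono.ge_of_tendsto hlim n) fun n J => (hf n J).2)
  have htop : brjuno (cf (greedySeq f)) ≠ ⊤ := ne_top_of_le_ne_top ENNReal.ofReal_ne_top hupper
  refine le_antisymm hupper (ENNReal.ofReal_le_of_le_toReal ?_)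
  -- The digit after the first `n` ones is raised by one: the values still converge.
  set z : ℕ → ℕ → ℕ := fun n =>
    extendByOnes (toDigits (greedyList f n ++ [f (n, greedyList f n) + 1])) with hz
  have hl := length_toDigits_greedyList f
  have hzlim : Tendsto (fun n => brjuno (cf (z n))) atTop (𝓝 (brjuno (cf (greedySeq f)))) := by
    refine tendsto_brjuno_cf ha (fun n => one_le_extendByOnes one_le_of_mem_toDigits)
      (fun n i hi => ?_) (fun n => ?_) (fun n i hi => ?_) htop
    · simp only [hz]
      rw [toDigits_append, extendByOnes_append_lt (by rwa [hl]), extendByOnes_greedyList hi]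
    · simp only [hz]
      rw [toDigits_append]
      refine le_of_eq ?_
      have := extendByOnes_append_length (toDigits (greedyList f n))
        (f (n, greedyList f n) + 1 + 1)
      rwa [hl] at this
    · simp only [hz]
      rw [toDigits_append]
      exact extendByOnes_of_length_le (by rw [List.length_append, hl, List.length_singleton]; omega)
  refine le_of_tendsto_of_tendsto' hlim
    (tendsto_value_bound ((ENNReal.tendsto_toReal htop).comp hzlim)) fun n => ?_
  have hb := bounds_listState hfin (M := 2 ^ n) (by positivity)
    (one_le_of_mem_toDigits (J := greedyList f n ++ [f (n, greedyList f n) + 1]))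
  have hex := (exceeds_iff hb.value_den _).1 (hf n (greedyList f n)).1
  refine hex.le.trans (hb.value_le.trans_eq ?_)
  rw [toDigits_append, List.length_append, hl, List.length_singleton, ← toDigits_append]
  push_cast
  simp only [Function.comp, hz]
  ring

end BrjunoComputability

theorem mainTheorem3 (y : ℝ) (hy : BrjunoComputability.IsLeftComputable y)
    (hle : (BrjunoComputability.brjuno ((Real.sqrt 5 - 1) / 2) : EReal) ≤ (y : EReal)) :
    ∃ x : ℝ, x ∈ Set.Ioo (0 : ℝ) 1 ∧ BrjunoComputability.IsComputableReal x ∧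
      (BrjunoComputability.brjuno x : EReal) = (y : EReal) := by
  obtain ⟨c, hc, hmono, hlim⟩ := hy
  rw [← BrjunoComputability.cf_one] at hle
  have hy0 : 0 ≤ y := EReal.coe_nonneg.1 ((EReal.coe_ennreal_nonneg _).trans hle)
  have hyc : ((ENNReal.ofReal y : ENNReal) : EReal) = y := by
    rw [EReal.coe_ennreal_ofReal, max_eq_left hy0]
  rw [← hyc, EReal.coe_ennreal_le_coe_ennreal_iff] at hle
  have hfin := ne_top_of_le_ne_top ENNReal.ofReal_ne_top hle
  obtain ⟨f, hf, hfc⟩ := BrjunoComputability.exists_computable_greedy hfin hc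
  have ha := BrjunoComputability.one_le_greedySeq f
  refine ⟨BrjunoComputability.cf (BrjunoComputability.greedySeq f),
    ⟨BrjunoComputability.cf_pos ha, BrjunoComputability.cf_lt_one ha⟩,
    BrjunoComputability.isComputableReal_cf_greedySeq hfin hf, ?_⟩
  rw [BrjunoComputability.brjuno_cf_greedySeq hfin hle hmono hlim hfc, hyc]
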